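/- For sets $A,B\subset\mathbb{E}^n$ and a family $\mathcal{B}$ of subsets of Euclidean space $\mathbb{E}^n$, let $C(A,\mathcal{B})$ be the smallest number of translates of elements of $\mathcal{B}$ required to cover $A$ (with value $\infty$ if no finite number suffices), and let $C(A,B)=C(A,\{B\})$. For families $\mathcal{A},\mathcal{B}$ of subsets of $\mathbb{E}^n$ let $C(\mathcal{A},\mathcal{B})=\sup_{A\in\mathcal{A}}C(A,\mathcal{B})$. A convex body is a compact convex set with non-empty interior. Let $H_n$ be the supremum of $C(K,\operatorname{int}K)$ over all convex bodies $K\subset\mathbb{E}^n$. Let $B_{n-2,n}$ be the $(n-2)$-skeleton of the unit cube $[0,1]^n$, i.e. the set of all points of the cube having at least two coordinates equal to $0$ or $1$. Let $e_i$ be the $i$-th basic unit vector, let $$\mathcal{A}_n=\Big\{\bigcup_{i=1}^n\{x_i,\,x_i+e_i\}:\ x_i,\ x_i+e_i\in[0,1]^n\ (1\le i\le n)\Big\},$$ $$\mathcal{P}_n=\Big\{\prod_{i=1}^n[x_i,x_i+\delta_i]:\ x_i\in\mathbb{R},\ \delta_i\ge0,\ \sum_{i=1}^n\delta_i<1\Big\},$$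 and let $C_n=C\big(\{A\cup B_{n-2,n}:A\in\mathcal{A}_n\},\,\mathcal{P}_n\big)$. **Proposition.** For every $n\ge3$, $H_n\le C_n$. -/

import Mathlib

open scoped Pointwise

namespace BoxCovering

/-- `n`-dimensional Euclidean space. -/
abbrev E (n : ℕ) : Type := EuclideanSpace ℝ (Fin n)

/-- The set `A` can be covered by `m` translates of elements of the family `𝓑`
(elements may be used several times, with different translation vectors). -/
def IsCoverable {n : ℕ} (A : Set (E n)) (𝓑 : Set (Set (E n))) (m : ℕ) : Prop :=
  ∃ (B : Fin m → Set (E n)) (v : Fin m → E n),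
    (∀ j, B j ∈ 𝓑) ∧ A ⊆ ⋃ j, v j +ᵥ B j

/-- `C(A, 𝓑)` for a set `A` and a family `𝓑`: the smallest number of translates of elements
of `𝓑` required to cover `A` (`⊤` if no finite number suffices). -/
noncomputable def coverFamily {n : ℕ} (A : Set (E n)) (𝓑 : Set (Set (E n))) : ℕ∞ :=
  ⨅ (m : ℕ) (_ : IsCoverable A 𝓑 m), (m : ℕ∞)

/-- `C(A, B)` for two sets: the smallest number of translates of `B` required to cover `A`. -/
noncomputable def coverSet {n : ℕ} (A B : Set (E n)) : ℕ∞ := coverFamily A {B}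

/-- `C(𝓐, 𝓑)` for two families: the supremum of `C(A, 𝓑)` over `A ∈ 𝓐`. -/
noncomputable def coverFamilies {n : ℕ} (𝓐 𝓑 : Set (Set (E n))) : ℕ∞ :=
  ⨆ A ∈ 𝓐, coverFamily A 𝓑

/-- The Hadwiger number `H_n`: the supremum of `C(K, int K)` over all convex bodies `K`, that is,
compact convex subsets of `n`-dimensional Euclidean space with nonempty interior. -/
noncomputable def hadwigerNumber (n : ℕ) : ℕ∞ :=
  ⨆ (K : ConvexBody (E n)) (_ : (interior (K : Set (E n))).Nonempty),
    coverSet (K : Set (E n)) (interior (K : Set (E n)))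

/-- The unit cube `[0,1]^n`. -/
def unitCube (n : ℕ) : Set (E n) := {x | ∀ i, x i ∈ Set.Icc (0 : ℝ) 1}

/-- The `k`-skeleton of the unit cube `[0,1]^n` (for `k ≤ n`): the points of the cube having at
least `n - k` coordinates equal to `0` or `1`. -/
def skeleton (k n : ℕ) : Set (E n) :=
  {x | x ∈ unitCube n ∧ n - k ≤ {i : Fin n | x i = 0 ∨ x i = 1}.ncard}

/-- The `i`-th basic unit vector. -/
noncomputable abbrev basisVec {n : ℕ} (i : Fin n) : E n := EuclideanSpace.single i (1 : ℝ)

/-- The collection of the sets `⋃ i, {x_i, x_i + e_i}` with all `x_i, x_i + e_i` in the cube. -/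
def pairConfigurations (n : ℕ) : Set (Set (E n)) :=
  {A | ∃ x : Fin n → E n,
    (∀ i, x i ∈ unitCube n ∧ x i + basisVec i ∈ unitCube n) ∧
      A = ⋃ i, {x i, x i + basisVec i}}

/-- The box `∏ i, [x_i, x_i + δ_i]`. -/
def box {n : ℕ} (x : E n) (δ : Fin n → ℝ) : Set (E n) :=
  {y | ∀ i, y i ∈ Set.Icc (x i) (x i + δ i)}

/-- The family of all boxes (possibly degenerate) with total side length less than `1`. -/
def smallBoxes (n : ℕ) : Set (Set (E n)) :=
  {P | ∃ (x : E n) (δ : Fin n → ℝ), (∀ i, 0 ≤ δ i) ∧ ∑ i, δ i < 1 ∧ P = box x δ}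

/-- The covering number `C_n = C(𝓐_n ∪ B_{n-2,n}, 𝓟_n)`, used for `n ≥ 2`: here
`𝓐_n ∪ B_{n-2,n}` is the collection of the sets `A ∪ B_{n-2,n}` with `A ∈ 𝓐_n`. -/
noncomputable def boxCoverNumber (n : ℕ) : ℕ∞ :=
  coverFamilies ((fun A => A ∪ skeleton (n - 2) n) '' pairConfigurations n) (smallBoxes n)

end BoxCovering

/-!
By Auerbach's lemma, applied to `K - K`, every convex body `K` has an affine image that lies in the
unit cube and contains a pair `{a i, a i + e i}` for each `i`; let `K` be such an image. The
interior of `K` contains a translate of every box with side lengths `δ i` of sum less than `1`,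
because `∑ i, δ i • [a i, a i + e i] + (1 - ∑ i, δ i) • int K ⊆ int K`. On the other hand, every
point of `K` can be pushed away from points of `K` until it reaches one of the pairs or the
`(n - 2)`-skeleton: moving away from the point of the segment `[a i, a i + e i]` at the same height
keeps the `i`-th coordinate fixed and ends on a new facet of the cube. Therefore, if `m` small boxes
cover the pairs and the skeleton, the `m` translations that bring these boxes into `int K`
illuminate `K`, and by compactness `m` translates of `int K` cover `K`.
-/

namespace BoxCovering

open Filter Module Set Topology

section Auerbach

variable {𝕜 ι F : Type*} [NontriviallyNormedField 𝕜] [AddCommGroup F]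
  [Module 𝕜 F] [TopologicalSpace F] [ContinuousSMul 𝕜 F]

lemma continuous_basis_det [CompleteSpace 𝕜] [IsTopologicalAddGroup F] [T2Space F] [Fintype ι]
    [DecidableEq ι] (e : Basis ι 𝕜 F) : Continuous fun v : ι → F => e.det v := by
  have : FiniteDimensional 𝕜 F := e.finiteDimensional_of_finite
  simp only [Basis.det_apply]
  exact Continuous.matrix_det <| continuous_matrix fun i j =>
    (e.coord i).continuous_of_finiteDimensional.comp (continuous_apply j)

/-- **Auerbach's lemma**. The new basis maximizes the determinant, and by Cramer's rule its
coordinates are quotients of determinants. -/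
lemma exists_basis_forall_norm_coord_le_one [CompleteSpace 𝕜] [IsTopologicalAddGroup F]
    [T2Space F] [Finite ι] {D : Set F} (hD : IsCompact D) (e : Basis ι 𝕜 F) (he : ∀ i, e i ∈ D) :
    ∃ b : Basis ι 𝕜 F, (∀ i, b i ∈ D) ∧ ∀ u ∈ D, ∀ i, ‖b.coord i u‖ ≤ 1 := by
  classical
  have := Fintype.ofFinite ι
  obtain ⟨v, hvD, hmax⟩ := (isCompact_univ_pi fun _ : ι => hD).exists_isMaxOn
    ⟨e, fun i _ => he i⟩ (continuous_basis_det e).norm.continuousOn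
  have hdet : 0 < ‖e.det v‖ := by
    have h : ‖e.det e‖ ≤ ‖e.det v‖ := hmax fun i _ => he i
    rw [e.det_self, norm_one] at h
    exact one_pos.trans_le h
  obtain ⟨hli, hsp⟩ := e.is_basis_iff_det.2 (isUnit_iff_ne_zero.2 (norm_pos_iff.1 hdet))
  refine ⟨Basis.mk hli hsp.ge, fun i => by simpa using hvD i (mem_univ i), fun u hu i => ?_⟩
  have cramer : e.det v * (Basis.mk hli hsp.ge).coord i u = e.det (Function.update v i u) := by
    simpa using DFunLike.congr_fun (e.det_smul_mk_coord_eq_det_update hli hsp.ge i) u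
  have hupdate : Function.update v i u ∈ univ.pi fun _ => D :=
    update_mem_pi_iff_of_mem hvD |>.2 fun _ => hu
  have hle : ‖e.det v‖ * ‖(Basis.mk hli hsp.ge).coord i u‖ ≤ ‖e.det v‖ * 1 := by
    rw [← norm_mul, cramer, mul_one]
    exact hmax hupdate
  exact le_of_mul_le_mul_left hle hdet

lemma exists_basis_forall_mem_of_mem_nhds_zero [Finite ι] (e : Basis ι 𝕜 F) {D : Set F}
    (hD : D ∈ 𝓝 0) : ∃ b : Basis ι 𝕜 F, ∀ i, b i ∈ D := by
  have hsmall : ∀ᶠ t : 𝕜 in 𝓝[≠] 0, ∀ i, t • e i ∈ D := by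
    refine eventually_all.2 fun i => eventually_nhdsWithin_of_eventually_nhds ?_
    have h : Tendsto (fun t : 𝕜 => t • e i) (𝓝 0) (𝓝 0) :=
      (continuous_id.smul continuous_const).tendsto' _ _ (zero_smul 𝕜 _)
    exact h hD
  obtain ⟨t, htD, ht⟩ := (hsmall.and self_mem_nhdsWithin).exists
  refine ⟨e.isUnitSMul fun _ => isUnit_iff_ne_zero.2 ht, fun i => ?_⟩
  rw [Basis.isUnitSMul_apply]
  exact htD i

end Auerbach

section Convex

variable {V : Type*} [AddCommGroup V] [Module ℝ V] {K : Set V}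

/-- `IsPushedTo K x y` says that moving `x` straight away from some point of `K` leads to `y`. It is
encoded as: `x` is a convex combination, with positive weight on `y`, of `y` and a point of `K`;
weight `1` gives `y = x`. -/
def IsPushedTo (K : Set V) (x y : V) : Prop :=
  ∃ s ∈ Ioc (0 : ℝ) 1, ∃ p ∈ K, x = s • y + (1 - s) • p

lemma isPushedTo_self {x : V} (hx : x ∈ K) : IsPushedTo K x x :=
  ⟨1, by simp, x, hx, by simp⟩

lemma isPushedTo_add_smul_sub {p : V} (hp : p ∈ K) (x : V) {t : ℝ} (ht : 0 ≤ t) :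
    IsPushedTo K x (x + t • (x - p)) := by
  have ht' : 0 < 1 + t := by positivity
  refine ⟨(1 + t)⁻¹, ⟨inv_pos.2 ht', inv_le_one_of_one_le₀ (by linarith)⟩, p, hp, ?_⟩
  match_scalars <;> field_simp
  ring

lemma IsPushedTo.trans (hK : Convex ℝ K) {x y z : V} (hxy : IsPushedTo K x y)
    (hyz : IsPushedTo K y z) : IsPushedTo K x z := by
  obtain ⟨s, ⟨hs₀, hs₁⟩, p, hp, rfl⟩ := hxy
  obtain ⟨t, ⟨ht₀, ht₁⟩, q, hq, rfl⟩ := hyz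
  obtain ⟨r, hr, hrpq⟩ := hK.exists_mem_add_smul_eq hq hp
    (mul_nonneg hs₀.le (sub_nonneg.2 ht₁)) (sub_nonneg.2 hs₁)
  refine ⟨s * t, ⟨mul_pos hs₀ ht₀, mul_le_one₀ hs₁ ht₀.le ht₁⟩, r, hr, ?_⟩
  rw [show 1 - s * t = s * (1 - t) + (1 - s) by ring, hrpq]
  module

variable [TopologicalSpace V]

/-- The direction `u` illuminates the point `x` of the convex body `K` if a ray that starts at `x`
in direction `u` meets the interior of `K`. -/
def Illuminates (K : Set V) (u x : V) : Prop :=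
  ∃ t : ℝ, 0 < t ∧ x + t • u ∈ interior K

variable [IsTopologicalAddGroup V] [ContinuousConstSMul ℝ V]

lemma IsPushedTo.illuminates (hK : Convex ℝ K) {x y u : V} (hxy : IsPushedTo K x y)
    (hu : y + u ∈ interior K) : Illuminates K u x := by
  obtain ⟨s, ⟨hs₀, hs₁⟩, p, hp, rfl⟩ := hxy
  refine ⟨s, hs₀, ?_⟩
  convert hK.combo_interior_self_mem_interior hu hp hs₀ (sub_nonneg.2 hs₁) (by ring) using 1
  module

lemma eventually_forall_add_smul_mem_interior (hK : Convex ℝ K) {x u : V} {t : ℝ}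
    (hx : x + t • u ∈ interior K) :
    ∀ᶠ y in 𝓝[K] x, ∀ s ∈ Ioc 0 t, y + s • u ∈ interior K := by
  have hnear : ∀ᶠ y in 𝓝[K] x, y + t • u ∈ interior K :=
    (continuous_add_const (t • u)).continuousWithinAt.eventually_mem
      (isOpen_interior.mem_nhds hx)
  filter_upwards [hnear, self_mem_nhdsWithin] with y hy hyK s ⟨hs, hst⟩
  have ht : 0 < t := hs.trans_le hst
  simpa [smul_smul, div_mul_cancel₀ s ht.ne'] using
    hK.add_smul_mem_interior hyK hy ⟨div_pos hs ht, (div_le_one ht).2 hst⟩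

lemma exists_forall_exists_add_smul_mem_interior {ι : Type*} (hKc : IsCompact K)
    (hK : Convex ℝ K) (w : ι → V) (hw : ∀ x ∈ K, ∃ j, Illuminates K (w j) x) :
    ∃ t : ℝ, ∀ x ∈ K, ∃ j, x + t • w j ∈ interior K := by
  have hsmall : ∀ᶠ s : ℝ in 𝓝[>] 0, ∀ x ∈ K, ∃ j, x + s • w j ∈ interior K := by
    refine hKc.induction_on
      (p := fun S => ∀ᶠ s : ℝ in 𝓝[>] 0, ∀ x ∈ S, ∃ j, x + s • w j ∈ interior K)
      (by simp) (fun S T hST hT => hT.mono fun s hs x hx => hs x (hST hx))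
      (fun S T hS hT => ?_) fun x hx => ?_
    · filter_upwards [hS, hT] with s hsS hsT x hx
      exact hx.elim (hsS x) (hsT x)
    · obtain ⟨j, t, ht, hxt⟩ := hw x hx
      refine ⟨_, eventually_forall_add_smul_mem_interior hK hxt, ?_⟩
      filter_upwards [Ioc_mem_nhdsGT ht] with s hs y hy
      exact ⟨j, hy s hs⟩
  exact hsmall.exists

lemma sum_smul_add_smul_mem_interior {ι : Type*} (hK : Convex ℝ K) {s : Finset ι} {w : ι → ℝ}
    {z : ι → V} {p : V} (hw : ∀ i ∈ s, 0 ≤ w i) (hz : ∀ i ∈ s, z i ∈ K) (hp : p ∈ interior K)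
    (hs : ∑ i ∈ s, w i < 1) :
    ∑ i ∈ s, w i • z i + (1 - ∑ i ∈ s, w i) • p ∈ interior K := by
  rcases (Finset.sum_nonneg hw).eq_or_lt with h | h
  · have hzero : ∀ i ∈ s, w i • z i = 0 := fun i hi => by
      rw [(Finset.sum_eq_zero_iff_of_nonneg hw).1 h.symm i hi, zero_smul]
    rw [← h, Finset.sum_eq_zero hzero]
    simpa using hp
  · have hmass := hK.combo_interior_self_mem_interior hp (hK.centerMass_mem hw h hz)
      (sub_pos.2 hs) h.le (sub_add_cancel _ _)
    rwa [Finset.centerMass, smul_inv_smul₀ h.ne', add_comm] at hmass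

end Convex

section Covering

variable {n m : ℕ} {A B : Set (E n)}

lemma isCoverable_singleton_iff :
    IsCoverable A {B} m ↔ ∃ v : Fin m → E n, ∀ x ∈ A, ∃ j, x + v j ∈ B := by
  constructor
  · rintro ⟨B', v, hB', hcover⟩
    refine ⟨-v, fun x hx => ?_⟩
    obtain ⟨j, y, hy, rfl⟩ := mem_iUnion.1 (hcover hx)
    have hyB : y ∈ B := hB' j ▸ hy
    exact ⟨j, by simpa using hyB⟩
  · rintro ⟨v, hv⟩
    refine ⟨fun _ => B, -v, fun _ => rfl, fun x hx => ?_⟩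
    obtain ⟨j, hj⟩ := hv x hx
    exact mem_iUnion.2 ⟨j, x + v j, hj, by simp⟩

lemma coverFamily_le_coverFamily {A' : Set (E n)} {𝓑 𝓑' : Set (Set (E n))}
    (h : ∀ m, IsCoverable A' 𝓑' m → IsCoverable A 𝓑 m) :
    coverFamily A 𝓑 ≤ coverFamily A' 𝓑' :=
  le_iInf₂ fun m hm => iInf₂_le m (h m hm)

lemma coverSet_le_coverSet_image (f : E n ≃ᵃ[ℝ] E n) :
    coverSet A B ≤ coverSet (f '' A) (f '' B) := by
  refine coverFamily_le_coverFamily fun m hm => ?_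
  rw [isCoverable_singleton_iff] at hm ⊢
  obtain ⟨v, hv⟩ := hm
  refine ⟨fun j => f.linear.symm (v j), fun x hx => ?_⟩
  obtain ⟨j, hj⟩ := hv (f x) (mem_image_of_mem f hx)
  refine ⟨j, (f.injective.mem_set_image).1 ?_⟩
  have hshift : f (x + f.linear.symm (v j)) = f x + v j := by
    simpa [add_comm] using f.map_vadd x (f.linear.symm (v j))
  rwa [hshift]

end Covering

section Box

variable {n : ℕ}

lemma exists_forall_add_mem_interior_of_mem_smallBoxes {K : Set (E n)} (hK : Convex ℝ K)
    (hKi : (interior K).Nonempty) {a : Fin n → E n} (ha : ∀ i, a i ∈ K)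
    (ha' : ∀ i, a i + basisVec i ∈ K) {P : Set (E n)} (hP : P ∈ smallBoxes n) :
    ∃ w : E n, ∀ y ∈ P, y + w ∈ interior K := by
  obtain ⟨p, hp⟩ := hKi
  obtain ⟨x, δ, hδ, hδ₁, rfl⟩ := hP
  refine ⟨∑ i, δ i • a i + (1 - ∑ i, δ i) • p - x, fun y hy => ?_⟩
  let θ : Fin n → ℝ := fun i => (y i - x i) / δ i
  have hθ : ∀ i, θ i ∈ Icc 0 1 := fun i =>
    ⟨div_nonneg (sub_nonneg.2 (hy i).1) (hδ i),
      div_le_one_of_le₀ (sub_le_iff_le_add'.2 (hy i).2) (hδ i)⟩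
  have hδθ : ∀ i, δ i * θ i = y i - x i := fun i =>
    mul_div_cancel_of_imp' fun h => by
      have := hy i
      rw [h, add_zero, Icc_self] at this
      exact sub_eq_zero.2 this
  have hyx : y - x = ∑ i, (δ i * θ i) • basisVec i := by
    ext j
    simp [hδθ, Pi.single_apply]
  convert sum_smul_add_smul_mem_interior hK (fun i _ => hδ i)
    (fun i _ => hK.add_smul_mem (ha i) (ha' i) (hθ i)) hp hδ₁ using 1
  simp only [smul_add, Finset.sum_add_distrib, smul_smul, ← hyx]
  abel

end Box

section Cube

variable {n : ℕ}

lemma exists_add_mul_eq_zero_or_one {a d : ℝ} (ha : a ∈ Icc 0 1) (hd : d ≠ 0) :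
    ∃ T : ℝ, 0 ≤ T ∧ (a + T * d = 0 ∨ a + T * d = 1) ∧ ∀ t ∈ Icc 0 T, a + t * d ∈ Icc 0 1 := by
  obtain ⟨ha₀, ha₁⟩ := ha
  rcases hd.lt_or_gt with hd | hd
  · refine ⟨-a / d, div_nonneg_of_nonpos (neg_nonpos.2 ha₀) hd.le, Or.inl (by field_simp; ring),
      fun t ⟨ht₀, ht⟩ => ⟨?_, ?_⟩⟩
    · linarith [(le_div_iff_of_neg hd).1 ht]
    · linarith [mul_nonpos_of_nonneg_of_nonpos ht₀ hd.le]
  · refine ⟨(1 - a) / d, div_nonneg (sub_nonneg.2 ha₁) hd.le, Or.inr (by field_simp; ring),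
      fun t ⟨ht₀, ht⟩ => ⟨?_, ?_⟩⟩
    · positivity
    · linarith [(le_div_iff₀ hd).1 ht]

lemma exists_add_smul_mem_unitCube {z d : E n} (hz : z ∈ unitCube n) (hd : d ≠ 0) :
    ∃ t : ℝ, 0 ≤ t ∧ z + t • d ∈ unitCube n ∧
      ∃ j, d j ≠ 0 ∧ ((z + t • d) j = 0 ∨ (z + t • d) j = 1) := by
  choose! T hT₀ hTend hT using fun j (hj : d j ≠ 0) => exists_add_mul_eq_zero_or_one (hz j) hj
  have hsupport : {j | d j ≠ 0}.Nonempty := by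
    by_contra! h
    exact hd (PiLp.ext fun j => not_not.1 (eq_empty_iff_forall_notMem.1 h j))
  obtain ⟨j, hj, hmin⟩ := exists_min_image _ T (toFinite _) hsupport
  refine ⟨T j, hT₀ j hj, fun k => ?_, j, hj, hTend j hj⟩
  by_cases hk : d k = 0
  · simpa [hk] using hz k
  · exact hT k hk (T j) ⟨hT₀ j hj, hmin k hk⟩

lemma mem_skeleton_of_ne {x : E n} (hx : x ∈ unitCube n) {j k : Fin n} (hjk : j ≠ k)
    (hj : x j = 0 ∨ x j = 1) (hk : x k = 0 ∨ x k = 1) : x ∈ skeleton (n - 2) n := by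
  have hpair : ({j, k} : Set (Fin n)).ncard ≤ {i | x i = 0 ∨ x i = 1}.ncard :=
    ncard_le_ncard (pair_subset hj hk)
  rw [ncard_pair hjk] at hpair
  exact ⟨hx, by omega⟩

end Cube

/-- The set `K` lies in the unit cube and contains the pairs `{a i, a i + e i}`. By Auerbach's lemma
every convex body has an affine image of this kind. -/
structure IsAuerbachPosition {n : ℕ} (K : Set (E n)) (a : Fin n → E n) : Prop where
  subset_unitCube : K ⊆ unitCube n
  left_mem : ∀ i, a i ∈ K
  right_mem : ∀ i, a i + basisVec i ∈ K

lemma exists_isAuerbachPosition_image {F : Type*} [AddCommGroup F] [Module ℝ F]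
    [TopologicalSpace F] [IsTopologicalAddGroup F] [ContinuousSMul ℝ F] [T2Space F] {n : ℕ}
    (e : Basis (Fin n) ℝ F) {K : Set F} (hKc : IsCompact K) (hKi : (interior K).Nonempty) :
    ∃ (f : F ≃ᴬ[ℝ] E n) (a : Fin n → E n), IsAuerbachPosition (f '' K) a := by
  have hzero : K - K ∈ 𝓝 (0 : F) := by
    obtain ⟨p, hp⟩ := hKi
    exact mem_of_superset (isOpen_interior.sub_right.mem_nhds ⟨p, hp, p, hp, sub_self p⟩)
      (sub_subset_sub interior_subset interior_subset)
  have hcompact : IsCompact (K - K) :=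
    sub_eq_add_neg K K ▸ hKc.add hKc.neg
  obtain ⟨e', he'⟩ := exists_basis_forall_mem_of_mem_nhds_zero e hzero
  obtain ⟨b, hbK, hb⟩ := exists_basis_forall_norm_coord_le_one hcompact e' he'
  have hwidth : ∀ x ∈ K, ∀ y ∈ K, ∀ i, b.coord i x - b.coord i y ≤ 1 := fun x hx y hy i => by
    rw [← map_sub]
    exact (Real.le_norm_self _).trans (hb _ (sub_mem_sub hx hy) i)
  choose q hq p hp hqp using hbK
  have hcoord : ∀ i k, b.coord k (q i) = b.coord k (p i) + basisVec i k := fun i k => by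
    rw [← sub_eq_iff_eq_add', ← map_sub, show q i - p i = b i from hqp i]
    simp [Finsupp.single_apply, eq_comm]
  let c : E n := WithLp.toLp 2 fun i => -b.coord i (p i)
  let f : F ≃ᴬ[ℝ] E n :=
    (b.equivFunL.trans (EuclideanSpace.equiv (Fin n) ℝ).symm).toContinuousAffineEquiv.trans
      (ContinuousAffineEquiv.constVAdd ℝ (E n) c)
  have hf : ∀ x i, f x i = b.coord i x - b.coord i (p i) := fun x i => neg_add_eq_sub _ _
  refine ⟨f, fun i => f (p i), ?_, fun i => mem_image_of_mem f (hp i), fun i => ⟨q i, hq i, ?_⟩⟩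
  · rintro _ ⟨x, hx, rfl⟩ i
    have hqi : b.coord i (q i) = b.coord i (p i) + 1 := by simpa using hcoord i i
    rw [hf]
    exact ⟨by linarith [hwidth (q i) (hq i) x hx i], hwidth x hx (p i) (hp i) i⟩
  · ext k
    rw [PiLp.add_apply, hf, hf, hcoord]
    ring

namespace IsAuerbachPosition

variable {n : ℕ} {K : Set (E n)} {a : Fin n → E n}

lemma apply_self_eq_zero (h : IsAuerbachPosition K a) (i : Fin n) : a i i = 0 := by
  have hleft := (h.subset_unitCube (h.left_mem i) i).1
  have hright := (h.subset_unitCube (h.right_mem i) i).2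
  simp only [PiLp.add_apply, PiLp.single_apply, if_true] at hright
  linarith

lemma exists_isPushedTo_apply_eq (h : IsAuerbachPosition K a) (hK : Convex ℝ K) {x : E n}
    (hx : x ∈ unitCube n) (i : Fin n) (hxi : x ≠ a i + x i • basisVec i) :
    ∃ y ∈ unitCube n, IsPushedTo K x y ∧ y i = x i ∧ ∃ j, i ≠ j ∧ (y j = 0 ∨ y j = 1) := by
  have hq : a i + x i • basisVec i ∈ K := hK.add_smul_mem (h.left_mem i) (h.right_mem i) (hx i)
  have hdi : (x - (a i + x i • basisVec i)) i = 0 := by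
    simp [h.apply_self_eq_zero]
  obtain ⟨t, ht, hmem, j, hj, hyj⟩ := exists_add_smul_mem_unitCube hx (sub_ne_zero.2 hxi)
  refine ⟨_, hmem, isPushedTo_add_smul_sub hq x ht, ?_, j, ?_, hyj⟩
  · rw [PiLp.add_apply, PiLp.smul_apply, hdi, smul_zero, add_zero]
  · rintro rfl
    exact hj hdi

lemma exists_isPushedTo_pair (h : IsAuerbachPosition K a) {x : E n} (hx : x ∈ unitCube n)
    {i : Fin n} (hxi : x = a i + x i • basisVec i) :
    ∃ y ∈ ({a i, a i + basisVec i} : Set (E n)), IsPushedTo K x y := by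
  rcases (hx i).1.eq_or_lt with hzero | hpos
  · refine ⟨a i, Or.inl rfl, ?_⟩
    rw [hxi, ← hzero, zero_smul, add_zero]
    exact isPushedTo_self (h.left_mem i)
  · refine ⟨_, Or.inr rfl, x i, ⟨hpos, (hx i).2⟩, a i, h.left_mem i, ?_⟩
    nth_rw 1 [hxi]
    module

lemma exists_isPushedTo_pairs_union_skeleton (h : IsAuerbachPosition K a) (hK : Convex ℝ K)
    (hn : 0 < n) {x : E n} (hx : x ∈ unitCube n) :
    ∃ y ∈ (⋃ i, {a i, a i + basisVec i}) ∪ skeleton (n - 2) n, IsPushedTo K x y := by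
  by_cases! hline : ∃ i, x = a i + x i • basisVec i
  · obtain ⟨i, hxi⟩ := hline
    obtain ⟨y, hy, hxy⟩ := h.exists_isPushedTo_pair hx hxi
    exact ⟨y, Or.inl (mem_iUnion.2 ⟨i, hy⟩), hxy⟩
  obtain ⟨y, hy, hxy, -, j, -, hyj⟩ := h.exists_isPushedTo_apply_eq hK hx ⟨0, hn⟩ (hline _)
  by_cases hyline : y = a j + y j • basisVec j
  · obtain ⟨z, hz, hyz⟩ := h.exists_isPushedTo_pair hy hyline
    exact ⟨z, Or.inl (mem_iUnion.2 ⟨j, hz⟩), hxy.trans hK hyz⟩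
  · obtain ⟨z, hz, hyz, hzj, k, hjk, hzk⟩ := h.exists_isPushedTo_apply_eq hK hy j hyline
    exact ⟨z, Or.inr (mem_skeleton_of_ne hz hjk (hzj ▸ hyj) hzk), hxy.trans hK hyz⟩

lemma coverSet_interior_le (h : IsAuerbachPosition K a) (hn : 0 < n) (hKc : IsCompact K)
    (hK : Convex ℝ K) (hKi : (interior K).Nonempty) :
    coverSet K (interior K) ≤
      coverFamily ((⋃ i, {a i, a i + basisVec i}) ∪ skeleton (n - 2) n) (smallBoxes n) := by
  refine coverFamily_le_coverFamily fun m ⟨B, v, hB, hcover⟩ => ?_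
  choose w hw using fun j =>
    exists_forall_add_mem_interior_of_mem_smallBoxes hK hKi h.left_mem h.right_mem (hB j)
  have hillum : ∀ x ∈ K, ∃ j, Illuminates K (w j - v j) x := fun x hx => by
    obtain ⟨y, hy, hxy⟩ :=
      h.exists_isPushedTo_pairs_union_skeleton hK hn (h.subset_unitCube hx)
    obtain ⟨j, z, hz, rfl⟩ := mem_iUnion.1 (hcover hy)
    refine ⟨j, hxy.illuminates hK ?_⟩
    simpa [add_comm] using hw j z hz
  obtain ⟨t, ht⟩ := exists_forall_exists_add_smul_mem_interior hKc hK _ hillum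
  exact isCoverable_singleton_iff.2 ⟨fun j => t • (w j - v j), ht⟩

lemma coverFamily_le_boxCoverNumber (h : IsAuerbachPosition K a) :
    coverFamily ((⋃ i, {a i, a i + basisVec i}) ∪ skeleton (n - 2) n) (smallBoxes n) ≤
      boxCoverNumber n := by
  have hpairs : (⋃ i, {a i, a i + basisVec i}) ∈ pairConfigurations n :=
    ⟨a, fun i => ⟨h.subset_unitCube (h.left_mem i), h.subset_unitCube (h.right_mem i)⟩, rfl⟩
  exact le_iSup₂_of_le _ (mem_image_of_mem _ hpairs) le_rfl

end IsAuerbachPosition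

lemma coverSet_interior_le_boxCoverNumber {n : ℕ} (hn : 0 < n) {K : Set (E n)}
    (hKc : IsCompact K) (hK : Convex ℝ K) (hKi : (interior K).Nonempty) :
    coverSet K (interior K) ≤ boxCoverNumber n := by
  obtain ⟨f, a, hfa⟩ :=
    exists_isAuerbachPosition_image (EuclideanSpace.basisFun (Fin n) ℝ).toBasis hKc hKi
  have hint : f '' interior K = interior (f '' K) := f.toHomeomorph.image_interior K
  calc coverSet K (interior K)
    _ ≤ coverSet (f '' K) (f '' interior K) := coverSet_le_coverSet_image f.toAffineEquiv
    _ = coverSet (f '' K) (interior (f '' K)) := by rw [hint]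
    _ ≤ coverFamily ((⋃ i, {a i, a i + basisVec i}) ∪ skeleton (n - 2) n) (smallBoxes n) :=
      hfa.coverSet_interior_le hn (hKc.image f.continuous)
        (hK.affine_image f.toAffineEquiv.toAffineMap) (hint ▸ hKi.image f)
    _ ≤ boxCoverNumber n := hfa.coverFamily_le_boxCoverNumber

end BoxCovering

/-- The case `n = 1` does not depend on the truncation of `n - 2`: the endpoints of `[0,1]`, which
then form `skeleton (n - 2) n`, are also the only pair. -/
theorem mainTheorem2_general (n : ℕ) (hn : 0 < n) :
    BoxCovering.hadwigerNumber n ≤ BoxCovering.boxCoverNumber n :=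
  iSup₂_le fun K hKi =>
    BoxCovering.coverSet_interior_le_boxCoverNumber hn K.isCompact K.convex hKi

theorem mainTheorem2 (n : ℕ) (hn : 3 ≤ n) :
    BoxCovering.hadwigerNumber n ≤ BoxCovering.boxCoverNumber n :=
  mainTheorem2_general n (by omega)
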